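/- Let $\sigma,r,b>0$ and consider the classical Lorenz system $$\dot x=\sigma(y-x),\qquad \dot y=rx-y-xz,\qquad \dot z=-bz+xy .$$ Write it as $\dot{\mathbf x}=f(\mathbf x)$ in $\mathbb R^3$ with solution $\mathbf x(t,x_0)$, $\mathbf x(0,x_0)=x_0$, let $J=\partial f/\partial\mathbf x$, and let $X(t,x_0)$ be the solution of $\dot X=J(\mathbf x(t,x_0))X$, $X(0,x_0)=I$. For $t>0$ let $\mathrm{LE}_i(t,x_0)=\frac1t\ln\sigma_i(X(t,x_0))$, $i=1,2,3$, where $\sigma_1\ge\sigma_2\ge\sigma_3>0$ are the singular values. Put $\mathrm{LD}(t,x_0)=0$ if $\mathrm{LE}_1(t,x_0)\le0$; $\mathrm{LD}(t,x_0)=3$ if $\sum_{i=1}^3\mathrm{LE}_i(t,x_0)\ge0$ (and $\mathrm{LE}_1(t,x_0)>0$); and otherwise $$\mathrm{LD}(t,x_0)=j+\frac{\mathrm{LE}_1(t,x_0)+\dots+\mathrm{LE}_j(t,x_0)}{|\mathrm{LE}_{j+1}(t,x_0)|},$$ where $j$ is the largest index with $\mathrm{LE}_1(t,x_0)+\dots+\mathrm{LE}_j(t,x_0)>0$.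 The Lyapunov dimension of an invariant compact set $K$ is $\dim_LK=\sup_{x_0\in K}\limsup_{t\to+\infty}\mathrm{LD}(t,x_0)$. Let $K$ be a global attractor of the system, i.e. a nonempty bounded closed set that is invariant ($\mathbf x(t,K)=K$ for all $t\ge0$) and globally attractive ($\operatorname{dist}(\mathbf x(t,x_0),K)\to0$ as $t\to+\infty$ for every $x_0\in\mathbb R^3$). Assume that $$r-1>0,\qquad r-1\ge\frac{b(b+\sigma-1)^2-4\sigma(b+\sigma b-b^2)}{3\sigma^2},$$ and that one of the following two conditions holds: (a) $\sigma^2(r-1)(b-4)\le4\sigma(\sigma b+b-b^2)-b(b+\sigma-1)^2$; (b) $\sigma^2(r-1)(b-4)>4\sigma(\sigma b+b-b^2)-b(b+\sigma-1)^2$, and the quadratic equation in $\gamma$ $$(2\sigma-b+\gamma)^2\bigl(b(b+\sigma-1)^2-4\sigma(\sigma b+b-b^2)+\sigma^2(r-1)(b-4)\bigr)+4b\gamma(\sigma+1)\bigl(b(b+\sigma-1)^2-4\sigma(\sigma b+b-b^2)-3\sigma^2(r-1)\bigr)=0$$ has two distinct real roots, the greater of which is positive. If $\sigma r>(b+1)(b+\sigma)$,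 then $$\dim_LK=3-\frac{2(\sigma+b+1)}{\sigma+1+\sqrt{(\sigma-1)^2+4\sigma r}} .$$ -/

import Mathlib

open Set Filter Topology

/-! ### Autonomous systems `u' = f(u)` on `ℝⁿ`: solutions, fundamental matrices, attractors -/

/-- `u` solves `u' = f(u)` on `[0, ∞)` (one-sided derivative at `0`). -/
def IsForwardSolution {n : ℕ} (f : EuclideanSpace ℝ (Fin n) → EuclideanSpace ℝ (Fin n))
    (u : ℝ → EuclideanSpace ℝ (Fin n)) : Prop :=
  ∀ t : ℝ, 0 ≤ t → HasDerivWithinAt u (f (u t)) (Ici 0) t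

/-- `X` is the fundamental matrix `X(t, x₀)`, normalized by `X(0, x₀) = I`, of the linearized
system along the solution `u` that starts at `x₀`: it satisfies the variational equation
`X' = J(u(t)) X` on `[0, ∞)`, where `J = fderiv ℝ f` is the Jacobian of `f`. Matrices are treated
as linear maps of Euclidean space. -/
def IsFundamentalMatrix {n : ℕ} (f : EuclideanSpace ℝ (Fin n) → EuclideanSpace ℝ (Fin n))
    (x₀ : EuclideanSpace ℝ (Fin n))
    (X : ℝ → EuclideanSpace ℝ (Fin n) →L[ℝ] EuclideanSpace ℝ (Fin n)) : Prop :=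
  ∃ u : ℝ → EuclideanSpace ℝ (Fin n), IsForwardSolution f u ∧ u 0 = x₀ ∧
    X 0 = ContinuousLinearMap.id ℝ (EuclideanSpace ℝ (Fin n)) ∧
    ∀ t : ℝ, 0 ≤ t → HasDerivWithinAt X ((fderiv ℝ f (u t)).comp (X t)) (Ici 0) t

/-- A global attractor: a (nonempty) bounded closed set which is invariant, that is, the time-`t`
map sends `K` onto `K` for every `t ≥ 0`, and which is globally attractive. Attraction is required
for each solution separately, so that sets which attract bounded sets uniformly are included. -/
structure IsGlobalAttractor {n : ℕ} (f : EuclideanSpace ℝ (Fin n) → EuclideanSpace ℝ (Fin n))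
    (K : Set (EuclideanSpace ℝ (Fin n))) : Prop where
  nonempty : K.Nonempty
  bounded : Bornology.IsBounded K
  closed : IsClosed K
  invariant : ∀ t : ℝ, 0 ≤ t → {y | ∃ u, IsForwardSolution f u ∧ u 0 ∈ K ∧ u t = y} = K
  attractive : ∀ u, IsForwardSolution f u → Tendsto (fun t => Metric.infDist (u t) K) atTop (𝓝 0)

/-! ### Lyapunov dimension -/

/-- The Lyapunov exponent functions `LEᵢ(t) = (1/t) ln σᵢ(A)` of `A = X(t, x₀)`, where
`σ₁ ≥ σ₂ ≥ ⋯` are the singular values; the index starts at `0`. -/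
noncomputable def lyapunovExponentFn {n : ℕ} (t : ℝ)
    (A : EuclideanSpace ℝ (Fin n) →L[ℝ] EuclideanSpace ℝ (Fin n)) (i : ℕ) : ℝ :=
  1 / t * Real.log ((A : EuclideanSpace ℝ (Fin n) →ₗ[ℝ] EuclideanSpace ℝ (Fin n)).singularValues i)

/-- The Kaplan-Yorke formula for a decreasing sequence `ℓ 0 ≥ ⋯ ≥ ℓ (n - 1)`: the value is `0` if
`ℓ 0 ≤ 0`, it is `n` if the whole sum is nonnegative, and otherwise
`j + (ℓ 0 + ⋯ + ℓ (j - 1)) / |ℓ j|`, where `j` is the largest index with `ℓ 0 + ⋯ + ℓ (j - 1) > 0`.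
In the last case `ℓ 0 + ⋯ + ℓ j ≤ 0`, so `ℓ j < 0` and the quotient lies in `(0, 1]`. -/
noncomputable def kaplanYorke (n : ℕ) (ℓ : ℕ → ℝ) : ℝ :=
  open Classical in
  if ℓ 0 ≤ 0 then 0
  else if 0 ≤ ∑ i ∈ Finset.range n, ℓ i then n
  else
    let j := Nat.findGreatest (fun k => 0 < ∑ i ∈ Finset.range k, ℓ i) n
    j + (∑ i ∈ Finset.range j, ℓ i) / |ℓ j|

/-- The local Lyapunov dimension `LD(x₀) = limsup_{t → ∞} LD(t, x₀)`. For a smooth `f` the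
fundamental matrix is unique on `[0, ∞)`, so that the supremum over `X` only names its value. -/
noncomputable def localLyapunovDim {n : ℕ}
    (f : EuclideanSpace ℝ (Fin n) → EuclideanSpace ℝ (Fin n))
    (x₀ : EuclideanSpace ℝ (Fin n)) : EReal :=
  ⨆ (X : ℝ → EuclideanSpace ℝ (Fin n) →L[ℝ] EuclideanSpace ℝ (Fin n))
    (_ : IsFundamentalMatrix f x₀ X),
    limsup (fun t : ℝ => ((kaplanYorke n (lyapunovExponentFn t (X t)) : ℝ) : EReal)) atTop

/-- The Lyapunov dimension `dim_L K = sup_{x₀ ∈ K} LD(x₀)`. -/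
noncomputable def lyapunovDim {n : ℕ}
    (f : EuclideanSpace ℝ (Fin n) → EuclideanSpace ℝ (Fin n))
    (K : Set (EuclideanSpace ℝ (Fin n))) : EReal :=
  ⨆ x₀ ∈ K, localLyapunovDim f x₀

/-! ### The Lorenz system -/

/-- The right-hand side of the classical Lorenz system. -/
noncomputable def lorenzField (σ r b : ℝ) (p : EuclideanSpace ℝ (Fin 3)) :
    EuclideanSpace ℝ (Fin 3) :=
  !₂[σ * (p 1 - p 0), r * p 0 - p 1 - p 0 * p 2, -b * p 2 + p 0 * p 1]

/-- The left-hand side of the quadratic equation in `γ`. -/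
def gammaPoly (σ r b γ : ℝ) : ℝ :=
  (2 * σ - b + γ) ^ 2 *
      (b * (b + σ - 1) ^ 2 - 4 * σ * (σ * b + b - b ^ 2) + σ ^ 2 * (r - 1) * (b - 4)) +
    4 * b * γ * (σ + 1) *
      (b * (b + σ - 1) ^ 2 - 4 * σ * (σ * b + b - b ^ 2) - 3 * σ ^ 2 * (r - 1))

/-! ### Singular values -/

namespace LinearMap

open Module

variable {E F : Type*} [NormedAddCommGroup E] [InnerProductSpace ℝ E] [FiniteDimensional ℝ E]
  [NormedAddCommGroup F] [InnerProductSpace ℝ F] [FiniteDimensional ℝ F]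

/-! Write `T = σ + b + 1`, `S = √((σ - 1)² + 4σr)`, `L = (σ + 1 + S) / 2`. The Lorenz field has
constant divergence `-T`, so the three exponents always sum to `-T` (`det_lorenz_variational`). If
the first two have positive sum, the Kaplan-Yorke value is `3 - T / |LE₃|`, so only the smallest
exponent matters.

Lower bound: the origin is an equilibrium lying in `K`, and `-L` is an eigenvalue there, so `LE₃ ≤
-L` (`localLyapunovDim_lorenz_zero_ge`).

Upper bound: every solution in `K` satisfies `LE₃ ≥ -L - O(1/t)` (`lorenz_variational_lower_bound`).
Tangent vectors are measured in a constant metric that symmetrizes the linearization at the origin.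
At other points the contraction rate may exceed that at the origin, but the surplus is at most a
multiple of `lorenzExcess` (`le_lorenzMetricDeriv`), which is dominated by minus the derivative of a
polynomial `V` (`exists_lorenzLyapunov`). As `V` is bounded on `K`, the surplus costs only a
constant factor. -/

theorem norm_apply_eigenvectorBasis_eq_singularValues (T : E →ₗ[ℝ] F) {n : ℕ}
    (hn : finrank ℝ E = n) (i : Fin n) :
    ‖T (T.isSymmetric_adjoint_comp_self.eigenvectorBasis hn i)‖ = T.singularValues i := by
  set e := T.isSymmetric_adjoint_comp_self.eigenvectorBasis hn with he
  have h1 : (adjoint T ∘ₗ T) (e i) = (T.singularValues i ^ 2) • e i := by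
    rw [he, T.isSymmetric_adjoint_comp_self.apply_eigenvectorBasis hn, T.sq_singularValues_fin hn]
    rfl
  have h2 : ‖T (e i)‖ ^ 2 = T.singularValues i ^ 2 := by
    rw [← real_inner_self_eq_norm_sq, ← adjoint_inner_left T, ← comp_apply, h1,
      real_inner_smul_left, real_inner_self_eq_norm_sq, e.norm_eq_one]
    simp
  exact (sq_eq_sq₀ (norm_nonneg _) (T.singularValues_nonneg _)).1 h2

/-- A lower bound for `T` on the unit sphere bounds all its singular values from below. -/
theorem le_singularValues_of_forall_le_norm (T : E →ₗ[ℝ] F) {c : ℝ}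
    (hT : ∀ v, c * ‖v‖ ≤ ‖T v‖) {i : ℕ} (hi : i < finrank ℝ E) : c ≤ T.singularValues i := by
  have h := hT (T.isSymmetric_adjoint_comp_self.eigenvectorBasis rfl ⟨i, hi⟩)
  rwa [T.norm_apply_eigenvectorBasis_eq_singularValues rfl ⟨i, hi⟩, OrthonormalBasis.norm_eq_one,
    mul_one] at h

/-- The smallest singular value is a lower bound for `T` on the unit sphere. -/
theorem singularValues_mul_norm_le (T : E →ₗ[ℝ] F) {n : ℕ} (hn : finrank ℝ E = n + 1) (v : E) :
    T.singularValues n * ‖v‖ ≤ ‖T v‖ := by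
  set e := T.isSymmetric_adjoint_comp_self.eigenvectorBasis hn with he
  have h1 : ‖T v‖ ^ 2 = ∑ i : Fin (n + 1), T.singularValues i ^ 2 * inner ℝ (e i) v ^ 2 := by
    rw [← real_inner_self_eq_norm_sq, ← adjoint_inner_left T, ← comp_apply, ← e.sum_inner_mul_inner]
    refine Finset.sum_congr rfl fun i _ => ?_
    rw [T.isSymmetric_adjoint_comp_self v (e i), he,
      T.isSymmetric_adjoint_comp_self.apply_eigenvectorBasis hn, ← T.sq_singularValues_fin hn,
      real_inner_comm v]
    simp only [RCLike.ofReal_real_eq_id, id_eq, real_inner_smul_right]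
    ring
  have h2 : ‖v‖ ^ 2 = ∑ i, inner ℝ (e i) v ^ 2 := by
    rw [← e.sum_sq_norm_inner_right]
    simp
  refine le_of_sq_le_sq ?_ (norm_nonneg _)
  rw [mul_pow, h1, h2, Finset.mul_sum]
  gcongr with i
  · exact T.singularValues_nonneg _
  · exact T.singularValues_antitone (Nat.lt_succ_iff.1 i.2)

theorem prod_singularValues_eq_abs_det (T : E →ₗ[ℝ] E) :
    ∏ i ∈ Finset.range (finrank ℝ E), T.singularValues i = |LinearMap.det T| := by
  rw [← normDet_eq_prod_singularValues, normDet_eq_abs_det]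

end LinearMap

/-! ### The Kaplan-Yorke formula for three exponents with negative sum -/

theorem kaplanYorke_three_eq {ℓ : ℕ → ℝ} (h₀ : 0 < ℓ 0) (h₁ : 0 < ℓ 0 + ℓ 1)
    (hsum : ℓ 0 + ℓ 1 + ℓ 2 < 0) :
    kaplanYorke 3 ℓ = 2 + (ℓ 0 + ℓ 1) / |ℓ 2| := by
  classical
  have h3 : ¬ 0 ≤ ∑ i ∈ Finset.range 3, ℓ i := by simpa [Finset.sum_range_succ] using hsum
  have hj : Nat.findGreatest (fun k => 0 < ∑ i ∈ Finset.range k, ℓ i) 3 = 2 := by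
    rw [Nat.findGreatest_eq_iff]
    refine ⟨by norm_num, fun _ => by simpa [Finset.sum_range_succ] using h₁, fun n hn hn' => ?_⟩
    obtain rfl : n = 3 := by omega
    exact fun h => h3 h.le
  rw [kaplanYorke, if_neg h₀.not_ge, if_neg h3]
  simp only
  have : ∀ j : ℕ, j = 2 → (j : ℝ) + (∑ i ∈ Finset.range j, ℓ i) / |ℓ j| =
      2 + (ℓ 0 + ℓ 1) / |ℓ 2| := by
    rintro _ rfl
    simp [Finset.sum_range_succ]
  refine this _ ?_
  convert! hj

/-- Unless the value is `0`, the last positive partial sum is the first one, and `ℓ 0 ≤ -ℓ 1` bounds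
the fraction by `1`. -/
theorem kaplanYorke_three_le_two {ℓ : ℕ → ℝ} (h₁ : ℓ 0 + ℓ 1 ≤ 0)
    (hsum : ℓ 0 + ℓ 1 + ℓ 2 < 0) : kaplanYorke 3 ℓ ≤ 2 := by
  classical
  by_cases h₀ : ℓ 0 ≤ 0
  · simp [kaplanYorke, h₀]
  have h3 : ¬ 0 ≤ ∑ i ∈ Finset.range 3, ℓ i := by simpa [Finset.sum_range_succ] using hsum
  rw [kaplanYorke, if_neg h₀, if_neg h3]
  push Not at h₀
  have hj : Nat.findGreatest (fun k => 0 < ∑ i ∈ Finset.range k, ℓ i) 3 = 1 := by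
    rw [Nat.findGreatest_eq_iff]
    refine ⟨by norm_num, fun _ => by simpa using h₀, fun n hn hn' => ?_⟩
    obtain rfl | rfl : n = 3 ∨ n = 2 := by omega
    · exact fun h => h3 h.le
    · simpa [Finset.sum_range_succ] using h₁
  have : ∀ j : ℕ, j = 1 → (j : ℝ) + (∑ i ∈ Finset.range j, ℓ i) / |ℓ j| ≤ 2 := by
    rintro _ rfl
    have h : ℓ 0 / |ℓ 1| ≤ 1 := by
      rw [abs_of_neg (by linarith), div_le_one (by linarith)]
      linarith
    simp only [Nat.cast_one, Finset.sum_range_one]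
    linarith
  refine this _ ?_
  convert! hj

/-- Here `ℓ 0 + ℓ 1 = -T - ℓ 2 ≥ L - T > 0`, and the value `3 - T / |ℓ 2|` increases with `|ℓ 2|`.
-/
theorem three_sub_div_le_kaplanYorke {ℓ : ℕ → ℝ} {T L : ℝ} (hT : 0 < T) (hTL : T < L)
    (hℓ : ℓ 1 ≤ ℓ 0) (hsum : ℓ 0 + ℓ 1 + ℓ 2 = -T) (h₂ : ℓ 2 ≤ -L) :
    3 - T / L ≤ kaplanYorke 3 ℓ := by
  rw [kaplanYorke_three_eq (by linarith) (by linarith) (by linarith), abs_of_neg (by linarith),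
    show ℓ 0 + ℓ 1 = -ℓ 2 - T by linarith, sub_div, div_self (by linarith)]
  have : T / (-ℓ 2) ≤ T / L := by
    gcongr
    · linarith
    · linarith
  linarith

/-- The maximum with `2` covers the case `ℓ 0 + ℓ 1 ≤ 0`, so no relation between `M` and `T` is
needed. -/
theorem kaplanYorke_le_max {ℓ : ℕ → ℝ} {T M : ℝ} (hT : 0 < T)
    (hℓ : ℓ 1 ≤ ℓ 0) (hsum : ℓ 0 + ℓ 1 + ℓ 2 = -T) (h₂ : -M ≤ ℓ 2) :
    kaplanYorke 3 ℓ ≤ max 2 (3 - T / M) := by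
  by_cases h₁ : ℓ 0 + ℓ 1 ≤ 0
  · exact (kaplanYorke_three_le_two h₁ (by linarith)).trans (le_max_left _ _)
  push Not at h₁
  refine le_max_of_le_right ?_
  rw [kaplanYorke_three_eq (by linarith) (by linarith) (by linarith), abs_of_neg (by linarith),
    show ℓ 0 + ℓ 1 = -ℓ 2 - T by linarith, sub_div, div_self (by linarith)]
  have : T / M ≤ T / (-ℓ 2) := by
    gcongr
    · linarith
    · linarith
  linarith

/-! ### Quadratic forms -/

theorem quadratic_form_two_nonneg {α β κ : ℝ} (hα : 0 ≤ α) (hβ : 0 ≤ β) (h : κ ^ 2 ≤ 4 * α * β)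
    (p q : ℝ) : 0 ≤ α * p ^ 2 + κ * p * q + β * q ^ 2 := by
  rcases hα.eq_or_lt with rfl | hα
  · obtain rfl : κ = 0 := by nlinarith
    have := mul_nonneg hβ (sq_nonneg q)
    linarith
  · refine nonneg_of_mul_nonneg_right (a := 4 * α) ?_ (by positivity)
    nlinarith [sq_nonneg (2 * α * p + κ * q), mul_nonneg (sub_nonneg.2 h) (sq_nonneg q)]

/-- Times `β` the form is `(βs + Bp)² + (βq + Cp)² + (αβ - B² - C²)p²`. -/
theorem quadratic_form_three_nonneg {α β B C : ℝ} (hα : 0 ≤ α) (hβ : 0 ≤ β)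
    (h : B ^ 2 + C ^ 2 ≤ α * β) (p s q : ℝ) :
    0 ≤ α * p ^ 2 + β * (s ^ 2 + q ^ 2) + 2 * p * (B * s + C * q) := by
  rcases hβ.eq_or_lt with rfl | hβ
  · obtain rfl : B = 0 := by nlinarith [sq_nonneg C]
    obtain rfl : C = 0 := by nlinarith
    have := mul_nonneg hα (sq_nonneg p)
    linarith
  · refine nonneg_of_mul_nonneg_right (a := β) ?_ hβ
    nlinarith [sq_nonneg (β * s + B * p), sq_nonneg (β * q + C * p),
      mul_nonneg (sub_nonneg.2 h) (sq_nonneg p)]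

/-! ### A Lyapunov function for the Lorenz system -/

/-- The polynomial Lyapunov function, with undetermined coefficients. -/
noncomputable def lorenzLyapunov (σ c₁ c₂ c₃ c₄ g x y z : ℝ) : ℝ :=
  c₁ * z + c₂ * x ^ 2 + c₃ * y ^ 2 + (c₃ + σ * g) * z ^ 2 + c₄ * (x * y) - g * (x ^ 2 * z) +
    g / (4 * σ) * x ^ 4

/-- The derivative of `lorenzLyapunov` along the Lorenz field. -/
def lorenzLyapunovDeriv (σ r b c₁ c₂ c₃ c₄ g x y z : ℝ) : ℝ :=
  c₁ * (-b * z + x * y) + c₂ * (2 * x * (σ * (y - x))) + c₃ * (2 * y * (r * x - y - x * z)) +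
    (c₃ + σ * g) * (2 * z * (-b * z + x * y)) +
    c₄ * (σ * (y - x) * y + x * (r * x - y - x * z)) -
    g * (2 * x * (σ * (y - x)) * z + x ^ 2 * (-b * z + x * y)) + g * x ^ 3 * (y - x)

/-- `σ²` times the squared inverse of the scaling of the first coordinate that symmetrizes the
Lorenz linearization at the origin. -/
def lorenzScale (σ r b : ℝ) : ℝ := σ * r + (b - 1) * (σ - b)

/-- The excess over its value at the origin of the squared gap between the extreme eigenvalues of
the symmetrized Jacobian, divided by `σ² / lorenzScale σ r b`. -/
noncomputable def lorenzExcess (σ r b x y z : ℝ) : ℝ :=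
  z ^ 2 - 4 * lorenzScale σ r b / σ * z + (y + (b - 1) * x / σ) ^ 2

/-- With `κ` as the coefficient of `xy`, the left side becomes `R (y - x)²` minus a quadratic form
in `(x², z)`. Then `h₂` says `R ≤ 0`, and `h₁` is the discriminant condition for that form. -/
theorem exists_lorenzLyapunov_of_coeff {σ r b κ g μ : ℝ} (hσ : 0 < σ) (hb : 0 < b)
    (hμ : b * (b + σ - 1) ^ 2 - 4 * σ * (σ * b + b - b ^ 2) = (4 - μ) * (σ ^ 2 * (r - 1)))
    (hμ1 : 1 ≤ μ) (hg : 0 ≤ g) (h₁ : (κ - (2 * σ - b) * g) ^ 2 ≤ 4 * g * (μ - 1))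
    (h₂ : (σ + 1) * κ + 1 ≤ μ / b) :
    ∃ c₁ c₂ c₃ c₄ g : ℝ, ∀ x y z,
      lorenzLyapunovDeriv σ r b c₁ c₂ c₃ c₄ g x y z + lorenzExcess σ r b x y z ≤ 0 := by
  set A := lorenzScale σ r b with hA
  have hA' : A = σ * (r - 1) + (σ * b + b - b ^ 2) := by rw [hA, lorenzScale]; ring
  set m := μ / b with hm
  have hmb : m * b = μ := by rw [hm]; field_simp
  -- `c₁` cancels the term linear in `z`. `R` is the coefficient of `y²`, and `c₂` makes that of
  -- `xy` equal to `-2R`. `c₃` makes the form in `(x, y)` vanish on `x = y`, which is `hN` and uses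
  -- the definition of `μ`; the form is then `R (y - x)²`.
  set c₁ := -4 * A / (σ * b) with hc₁
  set c₃ := (m - κ) / 2 with hc₃
  set R := -2 * c₃ + σ * κ + 1 with hR
  set c₂ := -(c₁ + 2 * r * c₃ - (σ + 1) * κ + 2 * (b - 1) / σ + 2 * R) / (2 * σ) with hc₂
  refine ⟨c₁, c₂, c₃, κ, g, fun x y z => ?_⟩
  have hc₁b : c₁ * b = -4 * A / σ := by rw [hc₁]; field_simp
  have hc₂σ : 2 * σ * c₂ = -(c₁ + 2 * r * c₃ - (σ + 1) * κ + 2 * (b - 1) / σ + 2 * R) := by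
    rw [hc₂]; field_simp
  have hN : c₁ + ((b - 1) / σ + 1) ^ 2 + (r - 1) * (2 * c₃ + κ) = 0 := by
    have h : b * σ ^ 2 * (c₁ + ((b - 1) / σ + 1) ^ 2 + (r - 1) * (2 * c₃ + κ)) = 0 := by
      have e₁ : b * σ ^ 2 * c₁ = -4 * σ * A := by rw [hc₁]; field_simp
      have e₂ : b * σ ^ 2 * ((b - 1) / σ + 1) ^ 2 = b * (b + σ - 1) ^ 2 := by field_simp; ring
      have e₃ : 2 * c₃ + κ = m := by rw [hc₃]; ring
      rw [mul_add, mul_add, e₁, e₂, e₃, hA']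
      linear_combination hμ + σ ^ 2 * (r - 1) * hmb
    exact (mul_eq_zero.1 h).resolve_left (by positivity)
  have hR0 : R ≤ 0 := by rw [hR, hc₃]; linarith
  have hform : 0 ≤ g * (x ^ 2) ^ 2 + (κ - (2 * σ + b) * g) * x ^ 2 * z +
      (μ - b * κ + 2 * b * σ * g - 1) * z ^ 2 := by
    have hdisc : (κ - (2 * σ + b) * g) ^ 2 ≤ 4 * g * (μ - b * κ + 2 * b * σ * g - 1) := by
      nlinarith
    refine quadratic_form_two_nonneg hg ?_ hdisc _ _
    rcases hg.eq_or_lt with rfl | hg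
    · obtain rfl : κ = 0 := by nlinarith
      linarith
    · exact nonneg_of_mul_nonneg_right ((sq_nonneg _).trans hdisc) (by positivity)
  have key : lorenzLyapunovDeriv σ r b c₁ c₂ c₃ κ g x y z + lorenzExcess σ r b x y z =
      R * (y - x) ^ 2 - (g * (x ^ 2) ^ 2 + (κ - (2 * σ + b) * g) * x ^ 2 * z +
        (μ - b * κ + 2 * b * σ * g - 1) * z ^ 2) := by
    have hk : (b - 1) * x / σ = (b - 1) / σ * x := by ring
    have hk' : 2 * (b - 1) / σ = 2 * ((b - 1) / σ) := by ring
    have hc₁b' : c₁ * b = -(4 * A / σ) := by rw [hc₁b]; ring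
    have hm' : 2 * c₃ * b = μ - b * κ := by rw [hc₃]; linear_combination hmb
    rw [hk'] at hc₂σ
    unfold lorenzLyapunovDeriv lorenzExcess
    rw [hk, ← hA]
    generalize (b - 1) / σ = k at *
    generalize 4 * A / σ = a at *
    clear_value c₁ c₂ c₃ R
    linear_combination (-z) * hc₁b' + (x * y - x ^ 2) * hc₂σ + x ^ 2 * hN - z ^ 2 * hm' +
      (x ^ 2 - y ^ 2) * hR
  rw [key]
  have := mul_nonneg (neg_nonneg.2 hR0) (sq_nonneg (y - x))
  linarith

theorem exists_lorenzLyapunov {σ r b : ℝ} (hσ : 0 < σ) (hb : 0 < b) (hr1 : 0 < r - 1)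
    (hr2 : (b * (b + σ - 1) ^ 2 - 4 * σ * (b + σ * b - b ^ 2)) / (3 * σ ^ 2) ≤ r - 1)
    (hab :
      (σ ^ 2 * (r - 1) * (b - 4) ≤ 4 * σ * (σ * b + b - b ^ 2) - b * (b + σ - 1) ^ 2) ∨
      (4 * σ * (σ * b + b - b ^ 2) - b * (b + σ - 1) ^ 2 < σ ^ 2 * (r - 1) * (b - 4) ∧
        ∃ γ : ℝ, 0 < γ ∧ gammaPoly σ r b γ ≤ 0)) :
    ∃ c₁ c₂ c₃ c₄ g : ℝ, ∀ x y z,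
      lorenzLyapunovDeriv σ r b c₁ c₂ c₃ c₄ g x y z + lorenzExcess σ r b x y z ≤ 0 := by
  set D := σ ^ 2 * (r - 1) with hD
  have hD0 : 0 < D := by positivity
  rw [div_le_iff₀ (by positivity)] at hr2
  -- In terms of `μ`, `hr2` reads `1 ≤ μ`, alternative (a) reads `b ≤ μ`, and `gammaPoly` is `D`
  -- times `(2σ - b + γ)²(b - μ) - 4bγ(σ + 1)(μ - 1)`.
  obtain ⟨μ, hμ⟩ : ∃ μ, b * (b + σ - 1) ^ 2 - 4 * σ * (σ * b + b - b ^ 2) = (4 - μ) * D :=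
    ⟨4 - (b * (b + σ - 1) ^ 2 - 4 * σ * (σ * b + b - b ^ 2)) / D, by field_simp; ring⟩
  have hμ1 : 1 ≤ μ := by
    have : 0 ≤ D * (μ - 1) := by linarith
    linarith [nonneg_of_mul_nonneg_right this hD0]
  rcases hab with ha | ⟨hb', γ, hγ, hγp⟩
  · refine exists_lorenzLyapunov_of_coeff (κ := 0) (g := 0) hσ hb hμ hμ1 le_rfl (by simp) ?_
    have : 0 ≤ D * (μ - b) := by linarith
    have := nonneg_of_mul_nonneg_right this hD0
    rw [le_div_iff₀ hb]
    linarith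
  · have hμb : 0 < b - μ := by
      have : 0 < D * (b - μ) := by linarith
      exact pos_of_mul_pos_right this hD0.le
    have hpoly : (2 * σ - b + γ) ^ 2 * (b - μ) ≤ 4 * b * γ * (σ + 1) * (μ - 1) := by
      have : 0 ≤ D * (4 * b * γ * (σ + 1) * (μ - 1) - (2 * σ - b + γ) ^ 2 * (b - μ)) := by
        have e : gammaPoly σ r b γ =
            -(D * (4 * b * γ * (σ + 1) * (μ - 1) - (2 * σ - b + γ) ^ 2 * (b - μ))) := by
          unfold gammaPoly
          rw [hμ, hD]
          ring
        linarith
      linarith [nonneg_of_mul_nonneg_right this hD0]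
    -- With `κ = -γ g`, this `g` turns `h₂` into an equality; `h₁` divided by `g` is then `gammaPoly
    -- ≤ 0`.
    set g := (b - μ) / (b * (σ + 1) * γ) with hg
    have hg0 : 0 ≤ g := by positivity
    have hgγ : g * (b * (σ + 1) * γ) = b - μ := by rw [hg]; field_simp
    refine exists_lorenzLyapunov_of_coeff (κ := -γ * g) (g := g) hσ hb hμ hμ1 hg0 ?_ ?_
    · have h : (2 * σ - b + γ) ^ 2 * g ≤ 4 * (μ - 1) := by
        rw [hg, ← mul_div_assoc, div_le_iff₀ (by positivity)]
        linarith
      nlinarith [mul_le_mul_of_nonneg_right h hg0]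
    · rw [le_div_iff₀ hb]
      linarith

/-! ### The linearized Lorenz system -/

theorem hasDerivWithinAt_euclidean_apply {n : ℕ} {u : ℝ → EuclideanSpace ℝ (Fin n)}
    {u' : EuclideanSpace ℝ (Fin n)} {s : Set ℝ} {t : ℝ} (h : HasDerivWithinAt u u' s t)
    (i : Fin n) : HasDerivWithinAt (fun τ => u τ i) (u' i) s t :=
  ((EuclideanSpace.proj i : EuclideanSpace ℝ (Fin n) →L[ℝ] ℝ).hasFDerivAt.comp_hasDerivWithinAt
    t h :)

/-- The Jacobian of the Lorenz field. -/
noncomputable def lorenzJacobian (σ r b : ℝ) (p : EuclideanSpace ℝ (Fin 3)) :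
    EuclideanSpace ℝ (Fin 3) →L[ℝ] EuclideanSpace ℝ (Fin 3) :=
  LinearMap.toContinuousLinearMap
    { toFun := fun w => !₂[σ * (w 1 - w 0), (r - p 2) * w 0 - w 1 - p 0 * w 2,
        p 1 * w 0 + p 0 * w 1 - b * w 2]
      map_add' := fun v w => by
        ext i; fin_cases i <;> simp <;> ring
      map_smul' := fun c w => by
        ext i; fin_cases i <;> simp <;> ring }

theorem lorenzJacobian_apply (σ r b : ℝ) (p w : EuclideanSpace ℝ (Fin 3)) :
    lorenzJacobian σ r b p w = !₂[σ * (w 1 - w 0), (r - p 2) * w 0 - w 1 - p 0 * w 2,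
        p 1 * w 0 + p 0 * w 1 - b * w 2] := rfl

theorem hasFDerivAt_lorenzField (σ r b : ℝ) (p : EuclideanSpace ℝ (Fin 3)) :
    HasFDerivAt (lorenzField σ r b) (lorenzJacobian σ r b p) p := by
  rw [← hasFDerivWithinAt_univ, hasFDerivWithinAt_euclidean]
  intro i
  rw [hasFDerivWithinAt_univ]
  have h (j : Fin 3) : HasFDerivAt (fun q : EuclideanSpace ℝ (Fin 3) => q j)
      (EuclideanSpace.proj j : EuclideanSpace ℝ (Fin 3) →L[ℝ] ℝ) p :=
    (EuclideanSpace.proj j : EuclideanSpace ℝ (Fin 3) →L[ℝ] ℝ).hasFDerivAt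
  fin_cases i
  · refine (((h 1).sub (h 0)).const_mul σ).congr_fderiv ?_
    ext w
    simp [lorenzJacobian_apply]
  · refine ((((h 0).const_mul r).sub (h 1)).sub ((h 0).mul (h 2))).congr_fderiv ?_
    ext w
    simp [lorenzJacobian_apply]
    ring
  · refine (((h 2).const_mul (-b)).add ((h 0).mul (h 1))).congr_fderiv ?_
    ext w
    simp [lorenzJacobian_apply]
    ring

theorem hasDerivWithinAt_lorenz_apply {σ r b : ℝ} {u : ℝ → EuclideanSpace ℝ (Fin 3)}
    (hu : IsForwardSolution (lorenzField σ r b) u) {t : ℝ} (ht : 0 ≤ t) :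
    HasDerivWithinAt (fun τ => u τ 0) (σ * (u t 1 - u t 0)) (Ici 0) t ∧
    HasDerivWithinAt (fun τ => u τ 1) (r * u t 0 - u t 1 - u t 0 * u t 2) (Ici 0) t ∧
    HasDerivWithinAt (fun τ => u τ 2) (-b * u t 2 + u t 0 * u t 1) (Ici 0) t :=
  ⟨hasDerivWithinAt_euclidean_apply (hu t ht) 0, hasDerivWithinAt_euclidean_apply (hu t ht) 1,
    hasDerivWithinAt_euclidean_apply (hu t ht) 2⟩

theorem hasDerivWithinAt_variational_apply {σ r b : ℝ} {u : ℝ → EuclideanSpace ℝ (Fin 3)}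
    {X : ℝ → EuclideanSpace ℝ (Fin 3) →L[ℝ] EuclideanSpace ℝ (Fin 3)}
    (hX : ∀ t : ℝ, 0 ≤ t →
      HasDerivWithinAt X ((fderiv ℝ (lorenzField σ r b) (u t)).comp (X t)) (Ici 0) t)
    (v : EuclideanSpace ℝ (Fin 3)) {t : ℝ} (ht : 0 ≤ t) :
    HasDerivWithinAt (fun τ => X τ v 0) (σ * (X t v 1 - X t v 0)) (Ici 0) t ∧
    HasDerivWithinAt (fun τ => X τ v 1)
      ((r - u t 2) * X t v 0 - X t v 1 - u t 0 * X t v 2) (Ici 0) t ∧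
    HasDerivWithinAt (fun τ => X τ v 2)
      (u t 1 * X t v 0 + u t 0 * X t v 1 - b * X t v 2) (Ici 0) t := by
  have h := (hX t ht).clm_apply (hasDerivWithinAt_const t (Ici 0) v)
  rw [(hasFDerivAt_lorenzField σ r b (u t)).fderiv, map_zero, add_zero,
    ContinuousLinearMap.comp_apply, lorenzJacobian_apply] at h
  exact ⟨hasDerivWithinAt_euclidean_apply h 0, hasDerivWithinAt_euclidean_apply h 1,
    hasDerivWithinAt_euclidean_apply h 2⟩

/-- Liouville's formula: the Lorenz field has constant divergence `-(σ + b + 1)`. -/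
theorem det_lorenz_variational {σ r b : ℝ} {u : ℝ → EuclideanSpace ℝ (Fin 3)}
    {X : ℝ → EuclideanSpace ℝ (Fin 3) →L[ℝ] EuclideanSpace ℝ (Fin 3)}
    (hX0 : X 0 = ContinuousLinearMap.id ℝ (EuclideanSpace ℝ (Fin 3)))
    (hX : ∀ t : ℝ, 0 ≤ t →
      HasDerivWithinAt X ((fderiv ℝ (lorenzField σ r b) (u t)).comp (X t)) (Ici 0) t)
    {t : ℝ} (ht : 0 ≤ t) :
    LinearMap.det (X t : EuclideanSpace ℝ (Fin 3) →ₗ[ℝ] EuclideanSpace ℝ (Fin 3)) =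
      Real.exp (-(σ + b + 1) * t) := by
  let e (j : Fin 3) : EuclideanSpace ℝ (Fin 3) := EuclideanSpace.single j 1
  have hdet (τ : ℝ) : LinearMap.det (X τ : EuclideanSpace ℝ (Fin 3) →ₗ[ℝ] EuclideanSpace ℝ (Fin 3))
      = (Matrix.of fun i j => X τ (e j) i).det := by
    rw [← LinearMap.det_toMatrix (EuclideanSpace.basisFun (Fin 3) ℝ).toBasis]
    congr 1
  let G (τ : ℝ) : ℝ := (Matrix.of fun i j => X τ (e j) i).det * Real.exp ((σ + b + 1) * τ)
  have hG (τ : ℝ) (hτ : 0 ≤ τ) : HasDerivWithinAt G 0 (Ici 0) τ := by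
    obtain ⟨h00, h10, h20⟩ := hasDerivWithinAt_variational_apply hX (e 0) hτ
    obtain ⟨h01, h11, h21⟩ := hasDerivWithinAt_variational_apply hX (e 1) hτ
    obtain ⟨h02, h12, h22⟩ := hasDerivWithinAt_variational_apply hX (e 2) hτ
    have hexp : HasDerivWithinAt (fun τ => Real.exp ((σ + b + 1) * τ))
        (Real.exp ((σ + b + 1) * τ) * ((σ + b + 1) * 1)) (Ici 0) τ :=
      (((hasDerivAt_id τ).const_mul (σ + b + 1)).exp).hasDerivWithinAt
    simp only [G, Matrix.det_fin_three, Matrix.of_apply]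
    refine (((((((h00.mul h11).mul h22).sub ((h00.mul h12).mul h21)).sub
      ((h01.mul h10).mul h22)).add ((h01.mul h12).mul h20)).add ((h02.mul h10).mul h21)).sub
      ((h02.mul h11).mul h20)).mul hexp |>.congr_deriv ?_
    simp only [Pi.mul_apply, Pi.sub_apply, Pi.add_apply]
    ring
  have hconst := constant_of_has_deriv_right_zero (f := G) (a := 0) (b := t)
    (fun τ hτ => (hG τ hτ.1).continuousWithinAt.mono Icc_subset_Ici_self)
    (fun τ hτ => (hG τ hτ.1).mono (Ici_subset_Ici.2 hτ.1)) t ⟨ht, le_rfl⟩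
  have h0 : G 0 = 1 := by
    have : (Matrix.of fun i j => X 0 (e j) i).det = 1 := by
      rw [← hdet, hX0]
      exact LinearMap.det_id
    simp only [G, this, mul_zero, Real.exp_zero, mul_one]
  rw [h0] at hconst
  rw [hdet, neg_mul, Real.exp_neg]
  exact eq_inv_of_mul_eq_one_left hconst

/-- The squared norm of a tangent vector in the coordinates that symmetrize the Lorenz
linearization at the origin. -/
noncomputable def lorenzMetric (σ r b ξ η ζ : ℝ) : ℝ :=
  lorenzScale σ r b / σ ^ 2 * ξ ^ 2 + (η - (b - 1) / σ * ξ) ^ 2 + ζ ^ 2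

/-- The derivative of `lorenzMetric` along the linearized Lorenz system at `(x, y, z)`. -/
noncomputable def lorenzMetricDeriv (σ r b x y z ξ η ζ : ℝ) : ℝ :=
  lorenzScale σ r b / σ ^ 2 * (2 * ξ * (σ * (η - ξ))) +
    2 * (η - (b - 1) / σ * ξ) *
      (((r - z) * ξ - η - x * ζ) - (b - 1) / σ * (σ * (η - ξ))) +
    2 * ζ * (y * ξ + x * η - b * ζ)

/-- In the coordinates of the metric the symmetrized Jacobian is an arrow matrix with diagonal `-(σ
+ 1 - b), -b, -b`. Its extreme eigenvalues are `(-(σ + 1) ± G) / 2`, where `G² = h² + σ²/A (B² + C²)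
= S² + W`, and `G ≤ S + W / (2S)`. -/
theorem le_lorenzMetricDeriv {σ r b S : ℝ} (hσ : 0 < σ) (hA : 0 < lorenzScale σ r b) (hS : 0 < S)
    (hS2 : S ^ 2 = (σ - 1) ^ 2 + 4 * σ * r) (x y z ξ η ζ : ℝ) :
    -(σ + 1 + S + σ ^ 2 / lorenzScale σ r b * lorenzExcess σ r b x y z / (2 * S)) *
      lorenzMetric σ r b ξ η ζ ≤ lorenzMetricDeriv σ r b x y z ξ η ζ := by
  have hAdef : lorenzScale σ r b = σ * r + (b - 1) * (σ - b) := rfl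
  unfold lorenzMetric lorenzMetricDeriv lorenzExcess
  set A := lorenzScale σ r b with hA'
  set k := (b - 1) / σ with hk
  have hkσ : k * σ = b - 1 := by rw [hk]; field_simp
  have hkx : (b - 1) * x / σ = k * x := by rw [hk]; ring
  rw [hkx]
  set h := σ + 1 - 2 * b with hh
  set B := 2 * A / σ - z with hB
  set C := y + k * x with hC
  set W := σ ^ 2 / A * (z ^ 2 - 4 * A / σ * z + C ^ 2) with hW
  set N := S + W / (2 * S) with hN
  have hSW : S ^ 2 + W = h ^ 2 + σ ^ 2 / A * (B ^ 2 + C ^ 2) := by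
    have : σ ^ 2 / A * (2 * A / σ) ^ 2 = 4 * A := by field_simp; ring
    have e : S ^ 2 = h ^ 2 + 4 * A := by rw [hS2, hh, hAdef]; ring
    rw [e, hW, hB]
    linear_combination -this
  have hBC : 0 ≤ σ ^ 2 / A * (B ^ 2 + C ^ 2) := by positivity
  have hWS : W / (2 * S) * (2 * S) = W := by field_simp
  -- `W` may be negative, but `2SN = S² + (S² + W)` and `S² + W` is a sum of squares.
  have hN0 : 0 ≤ N := by
    have : N * (2 * S) = S ^ 2 + (S ^ 2 + W) := by rw [hN, add_mul, hWS]; ring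
    refine nonneg_of_mul_nonneg_left (b := 2 * S) ?_ (by positivity)
    rw [this, hSW]
    positivity
  have hN2 : h ^ 2 + σ ^ 2 / A * (B ^ 2 + C ^ 2) ≤ N ^ 2 := by
    rw [← hSW, hN]
    nlinarith [sq_nonneg (W / (2 * S))]
  have hNh : |h| ≤ N := abs_le_of_sq_le_sq (by linarith only [hN2, hBC]) hN0
  obtain ⟨hN1, hN3⟩ := abs_le.1 hNh
  have hform := quadratic_form_three_nonneg (α := (N - h) * (A / σ ^ 2)) (β := N + h) (B := B)
    (C := C) (mul_nonneg (by linarith) (by positivity)) (by linarith) (by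
      have e : A / σ ^ 2 * (σ ^ 2 / A * (B ^ 2 + C ^ 2)) = B ^ 2 + C ^ 2 := by field_simp
      rw [← e]
      have : 0 ≤ A / σ ^ 2 := by positivity
      nlinarith [mul_le_mul_of_nonneg_left hN2 this]) ξ (η - k * ξ) ζ
  have hNS : σ + 1 + S + W / (2 * S) = σ + 1 + N := by rw [hN]; ring
  rw [hNS]
  have hAk : A / σ = r - k + (b - 1) * (1 + k) - 2 * (b - 1) * k := by
    rw [hAdef, hk]; field_simp; ring
  have hAσ : A / σ ^ 2 * σ = A / σ := by field_simp
  have hB' : B = 2 * (A / σ) - z := by rw [hB]; ring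
  have key : A / σ ^ 2 * (2 * ξ * (σ * (η - ξ))) +
      2 * (η - k * ξ) * (((r - z) * ξ - η - x * ζ) - k * (σ * (η - ξ))) +
      2 * ζ * (y * ξ + x * η - b * ζ) +
      (σ + 1 + N) * (A / σ ^ 2 * ξ ^ 2 + (η - k * ξ) ^ 2 + ζ ^ 2) =
      (N - h) * (A / σ ^ 2) * ξ ^ 2 + (N + h) * ((η - k * ξ) ^ 2 + ζ ^ 2) +
        2 * ξ * (B * (η - k * ξ) + C * ζ) := by
    clear_value N B C h k
    linear_combination (2 * ξ * (η - k * ξ)) * hAσ - (2 * ξ * (η - k * ξ)) * hAk -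
      (2 * ξ * (η - k * ξ)) * hB' - 2 * ξ * ζ * hC +
      (2 * (A / σ ^ 2) * ξ ^ 2 - 2 * (η - k * ξ) * (η - ξ)) * hkσ +
      (A / σ ^ 2 * ξ ^ 2 - (η - k * ξ) ^ 2 - ζ ^ 2) * hh
  linarith

theorem lorenzMetric_bounds {σ r b : ℝ} (hσ : 0 < σ) (hA : 0 < lorenzScale σ r b) :
    ∃ m M : ℝ, 0 < m ∧ 0 < M ∧ ∀ w : EuclideanSpace ℝ (Fin 3),
      m * ‖w‖ ^ 2 ≤ lorenzMetric σ r b (w 0) (w 1) (w 2) ∧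
      lorenzMetric σ r b (w 0) (w 1) (w 2) ≤ M * ‖w‖ ^ 2 := by
  unfold lorenzMetric
  set P := lorenzScale σ r b / σ ^ 2 with hP
  have hP0 : 0 < P := by positivity
  set k := (b - 1) / σ
  -- The constants come from `η² ≤ 2(η - kξ)² + 2k²ξ²` and `(η - kξ)² ≤ 2η² + 2k²ξ²`.
  refine ⟨((1 + 2 * k ^ 2) / P + 3)⁻¹, P + 3 + 2 * k ^ 2, by positivity, by positivity,
    fun w => ?_⟩
  rw [EuclideanSpace.real_norm_sq_eq, Fin.sum_univ_three]
  generalize w 0 = ξ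
  generalize w 1 = η
  generalize w 2 = ζ
  have h₁ := sq_nonneg (η - 2 * k * ξ)
  have h₂ := sq_nonneg (η + k * ξ)
  constructor
  · rw [inv_mul_le_iff₀ (by positivity)]
    have e : ((1 + 2 * k ^ 2) / P + 3) * (P * ξ ^ 2 + (η - k * ξ) ^ 2 + ζ ^ 2) =
        (1 + 2 * k ^ 2) * ξ ^ 2 + (1 + 2 * k ^ 2) / P * ((η - k * ξ) ^ 2 + ζ ^ 2) +
          3 * (P * ξ ^ 2 + (η - k * ξ) ^ 2 + ζ ^ 2) := by
      field_simp
      ring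
    rw [e]
    have h₃ : 0 ≤ (1 + 2 * k ^ 2) / P * ((η - k * ξ) ^ 2 + ζ ^ 2) := by positivity
    have h₄ : 0 ≤ P * ξ ^ 2 := by positivity
    nlinarith [sq_nonneg (η - k * ξ), sq_nonneg ζ]
  · have h₃ : 0 ≤ P * η ^ 2 := by positivity
    have h₄ : 0 ≤ P * ζ ^ 2 := by positivity
    have h₅ : 0 ≤ k ^ 2 * η ^ 2 := by positivity
    have h₆ : 0 ≤ k ^ 2 * ζ ^ 2 := by positivity
    nlinarith [sq_nonneg ξ, sq_nonneg η, sq_nonneg ζ]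

/-- Along a solution in a compact set, the linearized Lorenz system contracts no vector faster
than at the rate of its most stable eigenvalue at the origin. -/
theorem lorenz_variational_lower_bound {σ r b S : ℝ} (hσ : 0 < σ) (hA : 0 < lorenzScale σ r b)
    (hS : 0 < S) (hS2 : S ^ 2 = (σ - 1) ^ 2 + 4 * σ * r)
    (hV : ∃ c₁ c₂ c₃ c₄ g : ℝ, ∀ x y z,
      lorenzLyapunovDeriv σ r b c₁ c₂ c₃ c₄ g x y z + lorenzExcess σ r b x y z ≤ 0)
    {K : Set (EuclideanSpace ℝ (Fin 3))} (hK : IsCompact K)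
    {u : ℝ → EuclideanSpace ℝ (Fin 3)} (hu : IsForwardSolution (lorenzField σ r b) u)
    (huK : ∀ t, 0 ≤ t → u t ∈ K)
    {X : ℝ → EuclideanSpace ℝ (Fin 3) →L[ℝ] EuclideanSpace ℝ (Fin 3)}
    (hX0 : X 0 = ContinuousLinearMap.id ℝ (EuclideanSpace ℝ (Fin 3)))
    (hX : ∀ t : ℝ, 0 ≤ t →
      HasDerivWithinAt X ((fderiv ℝ (lorenzField σ r b) (u t)).comp (X t)) (Ici 0) t) :
    ∃ c : ℝ, 0 < c ∧ ∀ t, 0 ≤ t → ∀ v,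
      c * Real.exp (-((σ + 1 + S) / 2) * t) * ‖v‖ ≤ ‖X t v‖ := by
  obtain ⟨c₁, c₂, c₃, c₄, g, hV⟩ := hV
  obtain ⟨m, M, hm, hM, hq⟩ := lorenzMetric_bounds hσ hA
  set a := σ ^ 2 / lorenzScale σ r b with ha
  have ha0 : 0 < a := by positivity
  let V (p : EuclideanSpace ℝ (Fin 3)) : ℝ := lorenzLyapunov σ c₁ c₂ c₃ c₄ g (p 0) (p 1) (p 2)
  have hVc : Continuous V := by unfold V lorenzLyapunov; fun_prop
  obtain ⟨C, hC⟩ := hK.exists_bound_of_continuousOn hVc.continuousOn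
  have hVu (t : ℝ) (ht : 0 ≤ t) : HasDerivWithinAt (fun τ => V (u τ))
      (lorenzLyapunovDeriv σ r b c₁ c₂ c₃ c₄ g (u t 0) (u t 1) (u t 2)) (Ici 0) t := by
    obtain ⟨hx, hy, hz⟩ := hasDerivWithinAt_lorenz_apply hu ht
    refine ((((((hz.const_mul c₁).add ((hx.pow 2).const_mul c₂)).add
      ((hy.pow 2).const_mul c₃)).add ((hz.pow 2).const_mul (c₃ + σ * g))).add
      ((hx.mul hy).const_mul c₄)).sub (((hx.pow 2).mul hz).const_mul g)).add
      ((hx.pow 4).const_mul (g / (4 * σ))) |>.congr_deriv ?_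
    simp only [lorenzLyapunovDeriv, Pi.pow_apply]
    field_simp
    push_cast
    ring
  have hqX (v : EuclideanSpace ℝ (Fin 3)) (t : ℝ) (ht : 0 ≤ t) :
      HasDerivWithinAt (fun τ => lorenzMetric σ r b (X τ v 0) (X τ v 1) (X τ v 2))
        (lorenzMetricDeriv σ r b (u t 0) (u t 1) (u t 2) (X t v 0) (X t v 1) (X t v 2))
        (Ici 0) t := by
    obtain ⟨hx, hy, hz⟩ := hasDerivWithinAt_variational_apply hX v ht
    refine (((hx.pow 2).const_mul (lorenzScale σ r b / σ ^ 2)).add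
      ((hy.sub (hx.const_mul ((b - 1) / σ))).pow 2)).add (hz.pow 2) |>.congr_deriv ?_
    simp only [lorenzMetricDeriv, Pi.sub_apply]
    push_cast
    ring
  -- The factor `exp (-a / (2S) * V)` absorbs the surplus `a / (2S) * lorenzExcess` in the decay
  -- rate, because `V' ≤ -lorenzExcess`.
  have hmono (v : EuclideanSpace ℝ (Fin 3)) : MonotoneOn (fun t =>
      lorenzMetric σ r b (X t v 0) (X t v 1) (X t v 2) *
        Real.exp ((σ + 1 + S) * t - a / (2 * S) * V (u t))) (Ici 0) := by
    have hd (t : ℝ) (ht : 0 ≤ t) := (hqX v t ht).mul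
      ((((hasDerivAt_id t).const_mul (σ + 1 + S)).hasDerivWithinAt.sub
        ((hVu t ht).const_mul (a / (2 * S)))).exp)
    refine monotoneOn_of_hasDerivWithinAt_nonneg (convex_Ici 0)
      (fun t ht => (hd t ht).continuousWithinAt)
      (fun t ht => (hd t (interior_subset ht)).mono interior_subset) fun t ht => ?_
    have h₁ := le_lorenzMetricDeriv hσ hA hS hS2 (u t 0) (u t 1) (u t 2)
      (X t v 0) (X t v 1) (X t v 2)
    have h₂ : 0 ≤ lorenzMetric σ r b (X t v 0) (X t v 1) (X t v 2) := by
      unfold lorenzMetric; positivity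
    have h₃ := mul_le_mul_of_nonneg_left (hV (u t 0) (u t 1) (u t 2))
      (show 0 ≤ a / (2 * S) by positivity)
    have h₄ := mul_le_mul_of_nonneg_right h₃ h₂
    rw [← ha, show a * lorenzExcess σ r b (u t 0) (u t 1) (u t 2) / (2 * S) =
      a / (2 * S) * lorenzExcess σ r b (u t 0) (u t 1) (u t 2) by ring] at h₁
    simp only [Pi.sub_apply, id_eq, mul_one]
    rw [mul_comm (Real.exp _), ← mul_assoc, ← add_mul]
    refine mul_nonneg ?_ (Real.exp_pos _).le
    linarith
  -- `m / M` compares the metric with the norm, `2 * C` bounds the variation of `V` between times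
  -- `0` and `t`, and the root appears because the metric is a squared norm.
  set c := √(m * Real.exp (-(a / (2 * S) * (2 * C))) / M) with hc
  refine ⟨c, by positivity, fun t ht v => ?_⟩
  have h₁ := hmono v self_mem_Ici ht ht
  have hw := (hq (X t v)).2
  have hv := (hq v).1
  simp only [hX0, ContinuousLinearMap.id_apply, mul_zero, zero_sub] at h₁
  have hCt := abs_le.1 (hC _ (huK t ht))
  have hC0 := abs_le.1 (hC _ (huK 0 le_rfl))
  have haS : 0 ≤ a / (2 * S) := by positivity
  have e₁ : Real.exp (-(a / (2 * S) * C)) ≤ Real.exp (-(a / (2 * S) * V (u 0))) := by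
    gcongr
    exact hC0.2
  have e₂ : Real.exp ((σ + 1 + S) * t - a / (2 * S) * V (u t)) ≤
      Real.exp ((σ + 1 + S) * t + a / (2 * S) * C) := by
    have := mul_le_mul_of_nonneg_left hCt.1 haS
    gcongr
    linarith
  have h₂ : m * ‖v‖ ^ 2 * Real.exp (-(a / (2 * S) * C)) ≤
      M * ‖X t v‖ ^ 2 * Real.exp ((σ + 1 + S) * t + a / (2 * S) * C) :=
    calc _ ≤ _ := mul_le_mul hv e₁ (Real.exp_pos _).le ((by positivity : 0 ≤ m * ‖v‖ ^ 2).trans hv)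
      _ ≤ _ := h₁
      _ ≤ _ := mul_le_mul hw e₂ (Real.exp_pos _).le (by positivity)
  refine le_of_sq_le_sq ?_ (norm_nonneg _)
  rw [mul_pow, mul_pow, hc, Real.sq_sqrt (by positivity), div_mul_eq_mul_div, div_mul_eq_mul_div,
    div_le_iff₀ hM]
  have h₃ := mul_le_mul_of_nonneg_right h₂ (Real.exp_pos (-((σ + 1 + S) * t + a / (2 * S) * C))).le
  rw [mul_assoc, mul_assoc (M * _), ← Real.exp_add, ← Real.exp_add, add_neg_cancel, Real.exp_zero,
    mul_one] at h₃
  rw [← Real.exp_nat_mul, mul_assoc m, ← Real.exp_add, mul_comm (‖X t v‖ ^ 2)]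
  convert! h₃ using 1
  rw [mul_right_comm]
  congr 2
  push_cast
  ring

/-! ### The exponents -/

/-- Positivity matters because `Real.log 0 = 0`. -/
theorem lyapunovExponentFn_le_of_le {t : ℝ} (ht : 0 < t)
    {A : EuclideanSpace ℝ (Fin 3) →L[ℝ] EuclideanSpace ℝ (Fin 3)} {i j : ℕ} (hij : i ≤ j)
    (hj : 0 < (A : EuclideanSpace ℝ (Fin 3) →ₗ[ℝ] EuclideanSpace ℝ (Fin 3)).singularValues j) :
    lyapunovExponentFn t A j ≤ lyapunovExponentFn t A i := by
  unfold lyapunovExponentFn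
  gcongr
  exact LinearMap.singularValues_antitone _ hij

theorem sum_lyapunovExponentFn_three {t T : ℝ} (ht : 0 < t)
    {A : EuclideanSpace ℝ (Fin 3) →L[ℝ] EuclideanSpace ℝ (Fin 3)}
    (hA : LinearMap.det (A : EuclideanSpace ℝ (Fin 3) →ₗ[ℝ] EuclideanSpace ℝ (Fin 3)) =
      Real.exp (-T * t)) :
    lyapunovExponentFn t A 0 + lyapunovExponentFn t A 1 + lyapunovExponentFn t A 2 = -T := by
  have h := LinearMap.prod_singularValues_eq_abs_det
    (A : EuclideanSpace ℝ (Fin 3) →ₗ[ℝ] EuclideanSpace ℝ (Fin 3))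
  rw [hA, abs_of_pos (Real.exp_pos _), finrank_euclideanSpace_fin, Finset.prod_range_succ,
    Finset.prod_range_succ, Finset.prod_range_one] at h
  have hne := h.trans_ne (Real.exp_pos _).ne'
  have h' := congrArg Real.log h
  rw [Real.log_exp, Real.log_mul (left_ne_zero_of_mul hne) (right_ne_zero_of_mul hne),
    Real.log_mul (left_ne_zero_of_mul (left_ne_zero_of_mul hne))
      (right_ne_zero_of_mul (left_ne_zero_of_mul hne))] at h'
  unfold lyapunovExponentFn
  rw [← mul_add, ← mul_add, h']
  field_simp

theorem singularValues_pos_of_det {A : EuclideanSpace ℝ (Fin 3) →L[ℝ] EuclideanSpace ℝ (Fin 3)}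
    (hA : LinearMap.det (A : EuclideanSpace ℝ (Fin 3) →ₗ[ℝ] EuclideanSpace ℝ (Fin 3)) ≠ 0)
    {i : ℕ} (hi : i < 3) :
    0 < (A : EuclideanSpace ℝ (Fin 3) →ₗ[ℝ] EuclideanSpace ℝ (Fin 3)).singularValues i := by
  have h := LinearMap.prod_singularValues_eq_abs_det
    (A : EuclideanSpace ℝ (Fin 3) →ₗ[ℝ] EuclideanSpace ℝ (Fin 3))
  rw [finrank_euclideanSpace_fin] at h
  rw [LinearMap.singularValues_pos_iff_ne_zero]
  exact Finset.prod_ne_zero_iff.1 (h.trans_ne (abs_ne_zero.2 hA)) i (Finset.mem_range.2 hi)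

/-! ### The fundamental matrix at the origin -/

theorem lorenzField_zero (σ r b : ℝ) : lorenzField σ r b 0 = 0 := by
  ext i; fin_cases i <;> simp [lorenzField]

theorem isForwardSolution_zero (σ r b : ℝ) :
    IsForwardSolution (lorenzField σ r b) fun _ => 0 := fun t _ => by
  rw [lorenzField_zero]
  exact hasDerivWithinAt_const _ _ _

theorem exp_smul_apply_eigenvector {E : Type*} [NormedAddCommGroup E] [NormedSpace ℝ E]
    [CompleteSpace E] {A : E →L[ℝ] E} {v : E} {μ : ℝ} (h : A v = μ • v) (t : ℝ) :
    NormedSpace.exp (t • A) v = Real.exp (μ * t) • v := by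
  have hd (τ : ℝ) : HasDerivAt (fun τ : ℝ => Real.exp (-μ * τ) • NormedSpace.exp (τ • A) v) 0 τ := by
    have h₁ := (hasDerivAt_exp_smul_const A τ).clm_apply (hasDerivAt_const τ v)
    have h₂ : HasDerivAt (fun τ => Real.exp (-μ * τ)) (Real.exp (-μ * τ) * (-μ * 1)) τ :=
      ((hasDerivAt_id τ).const_mul (-μ)).exp
    refine (h₂.smul h₁).congr_deriv ?_
    simp only [mul_apply_eq_comp, h, map_smul, map_zero, add_zero, mul_one, smul_smul,
      ← add_smul]
    rw [show Real.exp (-μ * τ) * μ + Real.exp (-μ * τ) * -μ = 0 by ring, zero_smul]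
  have hc := is_const_of_deriv_eq_zero (fun τ => (hd τ).differentiableAt) (fun τ => (hd τ).deriv) t 0
  simp only [mul_zero, Real.exp_zero, zero_smul, NormedSpace.exp_zero, one_smul,
    one_apply_eq_self] at hc
  conv_rhs => rw [← hc, smul_smul, ← Real.exp_add]
  simp

/-- The lower bound needs an actual fundamental matrix, as a supremum over none would be `⊥`. At the
equilibrium the variational equation has constant coefficients, so the operator exponential serves.
-/
theorem exists_fundamentalMatrix_lorenz_zero (σ r b : ℝ) :
    ∃ X : ℝ → EuclideanSpace ℝ (Fin 3) →L[ℝ] EuclideanSpace ℝ (Fin 3),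
      X 0 = ContinuousLinearMap.id ℝ (EuclideanSpace ℝ (Fin 3)) ∧
      (∀ t : ℝ, 0 ≤ t →
        HasDerivWithinAt X ((fderiv ℝ (lorenzField σ r b) 0).comp (X t)) (Ici 0) t) ∧
      ∀ v μ, lorenzJacobian σ r b 0 v = μ • v → ∀ t, X t v = Real.exp (μ * t) • v := by
  refine ⟨fun t => NormedSpace.exp (t • lorenzJacobian σ r b 0), ?_, fun t _ => ?_,
    fun v μ h t => exp_smul_apply_eigenvector h t⟩
  · exact (congrArg NormedSpace.exp (zero_smul ℝ _)).trans NormedSpace.exp_zero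
  · rw [(hasFDerivAt_lorenzField σ r b 0).fderiv]
    exact (hasDerivAt_exp_smul_const' (lorenzJacobian σ r b 0) t).hasDerivWithinAt

/-! ### Bounds for the Lyapunov dimension -/

theorem mem_of_isGlobalAttractor {n : ℕ}
    {f : EuclideanSpace ℝ (Fin n) → EuclideanSpace ℝ (Fin n)} {K : Set (EuclideanSpace ℝ (Fin n))}
    (hK : IsGlobalAttractor f K) {u : ℝ → EuclideanSpace ℝ (Fin n)} (hu : IsForwardSolution f u)
    (hu0 : u 0 ∈ K) {t : ℝ} (ht : 0 ≤ t) : u t ∈ K := by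
  rw [← hK.invariant t ht]
  exact ⟨u, hu, hu0, rfl⟩

/-- The constant solution keeps its distance to `K`, and attraction forces that distance to be zero.
-/
theorem zero_mem_of_isGlobalAttractor_lorenz {σ r b : ℝ} {K : Set (EuclideanSpace ℝ (Fin 3))}
    (hK : IsGlobalAttractor (lorenzField σ r b) K) : (0 : EuclideanSpace ℝ (Fin 3)) ∈ K := by
  rw [hK.closed.mem_iff_infDist_zero hK.nonempty]
  exact tendsto_nhds_unique tendsto_const_nhds (hK.attractive _ (isForwardSolution_zero σ r b))

/-- `hL` is the characteristic equation, at `-L`, of the block of the linearization acting on the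
plane `z = 0`. -/
theorem exists_eigenvector_lorenzJacobian_zero {σ r b L : ℝ} (hσ : 0 < σ)
    (hL : L ^ 2 - (σ + 1) * L + σ - r * σ = 0) :
    ∃ v : EuclideanSpace ℝ (Fin 3), v ≠ 0 ∧ lorenzJacobian σ r b 0 v = (-L) • v := by
  refine ⟨!₂[σ, σ - L, 0], fun h => ?_, ?_⟩
  · have := congrArg (fun w : EuclideanSpace ℝ (Fin 3) => w 0) h
    simp [hσ.ne'] at this
  · rw [lorenzJacobian_apply]
    ext i
    fin_cases i
    · simp; ring
    · simp; linear_combination -hL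
    · simp

/-- One eigenvector suffices: it gives `σ₃ ≤ exp (-L t)`, and the determinant controls the other two
exponents. -/
theorem localLyapunovDim_lorenz_zero_ge {σ r b S : ℝ} (hσ : 0 < σ) (hb : 0 < b)
    (hS2 : S ^ 2 = (σ - 1) ^ 2 + 4 * σ * r) (hS : σ + 1 + 2 * b < S) :
    ((3 - (σ + b + 1) / ((σ + 1 + S) / 2) : ℝ) : EReal) ≤
      localLyapunovDim (lorenzField σ r b) 0 := by
  obtain ⟨X, hX0, hXd, hXv⟩ := exists_fundamentalMatrix_lorenz_zero σ r b
  set L := (σ + 1 + S) / 2 with hL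
  have key (t : ℝ) (ht : 0 < t) :
      3 - (σ + b + 1) / L ≤ kaplanYorke 3 (lyapunovExponentFn t (X t)) := by
    have hdet := det_lorenz_variational (u := fun _ => 0) hX0 hXd ht.le
    have hpos {i : ℕ} (hi : i < 3) := singularValues_pos_of_det (hdet.trans_ne (Real.exp_pos _).ne') hi
    refine three_sub_div_le_kaplanYorke (by positivity) (by rw [hL]; linarith)
      (lyapunovExponentFn_le_of_le ht zero_le_one (hpos (by norm_num)))
      (sum_lyapunovExponentFn_three ht hdet) ?_
    obtain ⟨v, hv0, hv⟩ := exists_eigenvector_lorenzJacobian_zero (b := b) hσ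
      (show L ^ 2 - (σ + 1) * L + σ - r * σ = 0 by rw [hL]; linear_combination hS2 / 4)
    rw [← norm_pos_iff] at hv0
    have h₂ := LinearMap.singularValues_mul_norm_le
      (X t : EuclideanSpace ℝ (Fin 3) →ₗ[ℝ] EuclideanSpace ℝ (Fin 3)) (n := 2) (by simp) v
    rw [ContinuousLinearMap.coe_coe, hXv v (-L) hv, norm_smul,
      Real.norm_of_nonneg (Real.exp_pos _).le] at h₂
    have h₃ := Real.log_le_log (hpos (by norm_num)) (le_of_mul_le_mul_right h₂ hv0)
    rw [Real.log_exp] at h₃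
    rw [lyapunovExponentFn, one_div, inv_mul_le_iff₀ ht]
    linarith
  refine le_trans ?_ (le_iSup₂ (α := EReal) X
    ⟨fun _ => 0, isForwardSolution_zero σ r b, rfl, hX0, hXd⟩)
  refine le_limsup_of_frequently_le (Eventually.frequently ?_)
  filter_upwards [eventually_gt_atTop 0] with t ht
  exact EReal.coe_le_coe_iff.2 (key t ht)

theorem localLyapunovDim_lorenz_le {σ r b S : ℝ} (hσ : 0 < σ) (hb : 0 < b)
    (hA : 0 < lorenzScale σ r b)
    (hS2 : S ^ 2 = (σ - 1) ^ 2 + 4 * σ * r) (hS : σ + 1 + 2 * b < S)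
    (hV : ∃ c₁ c₂ c₃ c₄ g : ℝ, ∀ x y z,
      lorenzLyapunovDeriv σ r b c₁ c₂ c₃ c₄ g x y z + lorenzExcess σ r b x y z ≤ 0)
    {K : Set (EuclideanSpace ℝ (Fin 3))} (hK : IsGlobalAttractor (lorenzField σ r b) K)
    {x₀ : EuclideanSpace ℝ (Fin 3)} (hx₀ : x₀ ∈ K) :
    localLyapunovDim (lorenzField σ r b) x₀ ≤
      ((3 - (σ + b + 1) / ((σ + 1 + S) / 2) : ℝ) : EReal) := by
  refine iSup₂_le fun X hX => ?_
  obtain ⟨u, hu, hu0, hX0, hXd⟩ := hX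
  have huK (t : ℝ) (ht : 0 ≤ t) : u t ∈ K := mem_of_isGlobalAttractor hK hu (hu0 ▸ hx₀) ht
  obtain ⟨c, hc, hcX⟩ := lorenz_variational_lower_bound hσ hA (by linarith) hS2 hV
    (Metric.isCompact_of_isClosed_isBounded hK.closed hK.bounded) hu huK hX0 hXd
  set L := (σ + 1 + S) / 2 with hL
  have hTL : σ + b + 1 < L := by rw [hL]; linarith
  have hL0 : 0 < L := by linarith
  -- The constant `c` shifts the bound on the smallest exponent by `log c / t`, which vanishes in
  -- the limit; the maximum with `2` disappears because `σ + b + 1 < L`.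
  have hlim : Tendsto (fun t : ℝ => ((max 2 (3 - (σ + b + 1) / (L - Real.log c / t)) : ℝ) : EReal))
      atTop (𝓝 ((3 - (σ + b + 1) / L : ℝ) : EReal)) := by
    refine (continuous_coe_real_ereal.tendsto _).comp ?_
    have h₁ : Tendsto (fun t : ℝ => L - Real.log c / t) atTop (𝓝 (L - 0)) :=
      tendsto_const_nhds.sub (tendsto_const_nhds.div_atTop tendsto_id)
    rw [sub_zero] at h₁
    have h₂ : Tendsto (fun t : ℝ => max 2 (3 - (σ + b + 1) / (L - Real.log c / t))) atTop
        (𝓝 (max 2 (3 - (σ + b + 1) / L))) :=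
      tendsto_const_nhds.max (tendsto_const_nhds.sub (tendsto_const_nhds.div h₁ hL0.ne'))
    rwa [max_eq_right] at h₂
    have : (σ + b + 1) / L ≤ 1 := (div_le_one hL0).2 hTL.le
    linarith
  rw [← hlim.limsup_eq]
  refine limsup_le_limsup ?_
  filter_upwards [eventually_gt_atTop 0] with t ht
  rw [EReal.coe_le_coe_iff]
  have hdet := det_lorenz_variational hX0 hXd ht.le
  have hpos {i : ℕ} (hi : i < 3) := singularValues_pos_of_det (hdet.trans_ne (Real.exp_pos _).ne') hi
  refine kaplanYorke_le_max (by positivity)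
    (lyapunovExponentFn_le_of_le ht zero_le_one (hpos (by norm_num)))
    (sum_lyapunovExponentFn_three ht hdet) ?_
  have h₂ := LinearMap.le_singularValues_of_forall_le_norm
    (X t : EuclideanSpace ℝ (Fin 3) →ₗ[ℝ] EuclideanSpace ℝ (Fin 3)) (hcX t ht.le) (i := 2)
    (by simp)
  have h₃ := Real.log_le_log (by positivity) h₂
  rw [Real.log_mul hc.ne' (Real.exp_pos _).ne', Real.log_exp] at h₃
  rw [lyapunovExponentFn, one_div, le_inv_mul_iff₀ ht]
  have : t * -(L - Real.log c / t) = Real.log c + -L * t := by field_simp; ring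
  rwa [this]

theorem theorem4 (σ r b : ℝ) (hσ : 0 < σ) (hr : 0 < r) (hb : 0 < b)
    (hr1 : r - 1 > 0)
    (hr2 : r - 1 ≥ (b * (b + σ - 1) ^ 2 - 4 * σ * (b + σ * b - b ^ 2)) / (3 * σ ^ 2))
    (hab :
      (σ ^ 2 * (r - 1) * (b - 4) ≤ 4 * σ * (σ * b + b - b ^ 2) - b * (b + σ - 1) ^ 2) ∨
      (σ ^ 2 * (r - 1) * (b - 4) > 4 * σ * (σ * b + b - b ^ 2) - b * (b + σ - 1) ^ 2 ∧
        ∃ γ₁ γ₂ : ℝ, γ₁ < γ₂ ∧ gammaPoly σ r b γ₁ = 0 ∧ gammaPoly σ r b γ₂ = 0 ∧ 0 < γ₂))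
    (hσr : σ * r > (b + 1) * (b + σ))
    (K : Set (EuclideanSpace ℝ (Fin 3))) (hK : IsGlobalAttractor (lorenzField σ r b) K) :
    lyapunovDim (lorenzField σ r b) K =
      ((3 - 2 * (σ + b + 1) / (σ + 1 + √((σ - 1) ^ 2 + 4 * σ * r)) : ℝ) : EReal) := by
  set S := √((σ - 1) ^ 2 + 4 * σ * r) with hSdef
  have hS2 : S ^ 2 = (σ - 1) ^ 2 + 4 * σ * r := Real.sq_sqrt (by positivity)
  -- Squared, this is exactly `hσr`; it says that `L > σ + b + 1`, so the claimed dimension exceeds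
  -- `2`.
  have hS : σ + 1 + 2 * b < S := by
    refine Real.lt_sqrt_of_sq_lt ?_
    linarith
  -- By `hσr`, `lorenzScale σ r b` exceeds `(b + 1)(b + σ) + (b - 1)(σ - b) = 2b(σ + 1)`.
  have hA : 0 < lorenzScale σ r b := by
    unfold lorenzScale
    nlinarith [mul_pos hσ hb]
  have hV := exists_lorenzLyapunov hσ hb hr1 hr2
    (hab.imp_right fun ⟨h, _, γ, _, _, hγ, hγ0⟩ => ⟨h, γ, hγ0, hγ.le⟩)
  rw [show 2 * (σ + b + 1) / (σ + 1 + S) = (σ + b + 1) / ((σ + 1 + S) / 2) by field_simp]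
  refine le_antisymm (iSup₂_le fun x₀ hx₀ => localLyapunovDim_lorenz_le hσ hb hA hS2 hS hV hK hx₀) ?_
  exact (localLyapunovDim_lorenz_zero_ge hσ hb hS2 hS).trans
    (le_iSup₂ (f := fun x₀ _ => localLyapunovDim (lorenzField σ r b) x₀) 0
      (zero_mem_of_isGlobalAttractor_lorenz hK))
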